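/- Let $V$ be a finite set carrying a directed graph in which every arc has a positive length and every vertex can be reached from every other one (an undirected connected graph is the special case in which each edge is a pair of opposite arcs of equal length). Let $d(v,w)$ be the shortest-path distance from $v$ to $w$. Let $Q,P$ be probability distributions on $V$ that give positive mass to every vertex, and let $S^1\in V^N$ be the initial positions of $N$ vehicles. A policy is a map $\rho:V^N\times V\to\{1,\dots,N\}$. At each stage $t=1,2,\dots$ a user appears at $x_t\sim Q$; vehicle $k=\rho(S^t,x_t)$ is assigned to the user, at cost $c_t=d(S^t_k,x_t)$; and $S^{t+1}$ is obtained from $S^t$ by replacing $S^t_k$ with $y_t\sim P$, where all the $x_t,y_t$ are independent. The policy $\rho$ is optimal (from $S^1$) if its long-run average cost $\lim_{T\to\infty}\frac1T\sum_{t=1}^T\mathbb E[c_t]$ is minimal among all policies. It is anonymous if the location of the vehicle that it assigns does not change when the vehicles are relabelled, that is, if this location depends only on the multiset of vehicle positions and on the user. Let $\rho$ be an optimal policy. Let $s\in V^N$ be a vector of vehicle positions and $u\in V$ the position of the user, and let $v_1\neq v_2$ be two positions occupied by vehicles in $s$ such that $v_1$ lies on a shortest path from $v_2$ to $u$. (a)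 If $\rho$ is anonymous, or if $N<|V|$, then in state $s$ the policy $\rho$ does not assign to $u$ a vehicle located at $v_2$. (b) For an arbitrary optimal $\rho$: if in state $s$ it assigns to $u$ a vehicle located at $v_2$, then the long-run frequency of $s$ is zero, that is, $\lim_{T\to\infty}\frac1T\sum_{t=1}^T\mathbb P(S^t=s)=0$. -/

import Mathlib

open Filter Topology

/-- A directed graph in which every arc carries a positive length. An undirected weighted graph
is the special case in which `Adj` and `len` are symmetric. -/
structure WeightedDigraph (V : Type*) extends Digraph V where
  /-- The length of the arc from `v` to `w`; only its values on arcs are ever used. -/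
  len : V → V → ℝ
  len_pos : ∀ v w, Adj v w → 0 < len v w

namespace WeightedDigraph

/-- Directed walks from one vertex to another. -/
inductive Walk {V : Type*} (G : WeightedDigraph V) : V → V → Type _ where
  | nil (v : V) : Walk G v v
  | cons {u v w : V} (h : G.Adj u v) (p : Walk G v w) : Walk G u w

namespace Walk

variable {V : Type*} {G : WeightedDigraph V}

/-- The total length of a walk. -/
def length : ∀ {v w : V}, G.Walk v w → ℝ
  | _, _, nil _ => 0
  | _, _, @cons _ _ u v _ _ p => G.len u v + p.length

/-- The vertices visited by a walk, end points included. -/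
def support : ∀ {v w : V}, G.Walk v w → List V
  | _, _, nil v => [v]
  | _, _, @cons _ _ u _ _ _ p => u :: p.support

/-- A shortest path: no walk with the same end points is shorter. (As arc lengths are positive,
such a walk never repeats a vertex.) -/
def IsShortest {v w : V} (p : G.Walk v w) : Prop :=
  ∀ q : G.Walk v w, p.length ≤ q.length

end Walk

variable {V : Type*} (G : WeightedDigraph V)

/-- Every vertex can be reached from every other one (for an undirected graph: the graph is
connected). -/
def StronglyConnected : Prop :=
  ∀ v w : V, Nonempty (G.Walk v w)

/-- The shortest-path distance from `v` to `w`. -/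
noncomputable def dist (v w : V) : ℝ :=
  ⨅ p : G.Walk v w, p.length

end WeightedDigraph

/-- An assignment policy for `N` vehicles: given the positions of the vehicles and the position of
the new user, it returns the vehicle assigned to the user. -/
abbrev AssignmentPolicy (V : Type*) (N : ℕ) : Type _ :=
  (Fin N → V) → V → Fin N

namespace AssignmentPolicy

variable {V : Type*} {N : ℕ}

/-- The policy does not look at the labels of the vehicles: the location from which a vehicle is
sent does not change when the vehicles are relabelled. -/
def Anonymous (ρ : AssignmentPolicy V N) : Prop :=
  ∀ (s : Fin N → V) (σ : Equiv.Perm (Fin N)) (u : V), s (σ (ρ (s ∘ σ) u)) = s (ρ s u)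

section Dynamics

variable (Q P : PMF V)

/-- The law of the next state, from state `s`: a user `u` arrives with law `Q`, the vehicle assigned
to `u` leaves, and is replaced by a new vehicle at a location with law `P`, independent of `u`. -/
noncomputable def step (ρ : AssignmentPolicy V N) (s : Fin N → V) : PMF (Fin N → V) :=
  Q.bind fun u => P.bind fun y => PMF.pure (Function.update s (ρ s u) y)

/-- The law of the vehicle positions after `t` users have been served, starting from `s₁`. -/
noncomputable def law (ρ : AssignmentPolicy V N) (s₁ : Fin N → V) : ℕ → PMF (Fin N → V)
  | 0 => PMF.pure s₁
  | t + 1 => (law ρ s₁ t).bind (step Q P ρ)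

variable [Fintype V] (G : WeightedDigraph V)

/-- The expected cost of the user that arrives after `t` users have been served: the distance from
the assigned vehicle to the user. -/
noncomputable def expectedCost (ρ : AssignmentPolicy V N) (s₁ : Fin N → V) (t : ℕ) : ℝ :=
  ∑ s : Fin N → V, (law Q P ρ s₁ t s).toReal * ∑ u : V, (Q u).toReal * G.dist (s (ρ s u)) u

/-- `g` is the long-run average cost of `ρ` from the initial state `s₁`. -/
def HasAverageCost (ρ : AssignmentPolicy V N) (s₁ : Fin N → V) (g : ℝ) : Prop :=
  Tendsto (fun T : ℕ => (∑ t ∈ Finset.range T, expectedCost Q P G ρ s₁ t) / (T : ℝ)) atTop (𝓝 g)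

/-- `ρ` minimises the long-run average cost from the initial state `s₁` among all policies. -/
def IsOptimal (ρ : AssignmentPolicy V N) (s₁ : Fin N → V) : Prop :=
  ∃ g : ℝ, HasAverageCost Q P G ρ s₁ g ∧
    ∀ (ρ' : AssignmentPolicy V N) (g' : ℝ), HasAverageCost Q P G ρ' s₁ g' → g ≤ g'

end Dynamics

end AssignmentPolicy

/-! The optimality equation `bellman h = h + g` has a solution `h` that ignores labels and satisfies
h(vehicle at a) ≤ h(vehicle at b) + d(a,b). It is a limit of discounted relative values. The
equation itself makes this inequality strict for a ≠ b (`IsRegular.update_lt`), so sending the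
vehicle at v₂ past v₁ is strictly worse than sending the one at v₁
(`IsRegular.minCost_lt_assignCost`). By telescoping, average cost minus g is the average of the
nonnegative one-step loss `gap`. Optimality forces this average to vanish, hence states with
positive loss have frequency zero, which is (b). For (a), a user at an occupied vertex must be
served from that vertex in every non-null state. So the non-null states form an `IsMovable` set,
which contains every state up to relabelling. If N < |V|, a vacant vertex lets vehicles exchange
places, and every state is non-null. -/

namespace PMF

/-! ### Expectations on finite types. -/

variable {α β : Type*}

theorem toReal_apply_pos {p : PMF α} {x : α} (h : p x ≠ 0) : 0 < (p x).toReal :=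
  ENNReal.toReal_pos h (p.apply_ne_top x)

variable [Fintype α]

/-- The expectation of a real function under a probability distribution on a finite type. -/
noncomputable def mean (p : PMF α) (f : α → ℝ) : ℝ := ∑ x, (p x).toReal * f x

theorem sum_toReal (p : PMF α) : ∑ x, (p x).toReal = 1 := by
  rw [← ENNReal.toReal_sum (fun x _ => p.apply_ne_top x), ← tsum_fintype (L := .unconditional _),
    p.tsum_coe, ENNReal.toReal_one]

theorem mean_const (p : PMF α) (c : ℝ) : p.mean (fun _ => c) = c := by
  simp [mean, ← Finset.sum_mul, sum_toReal]

theorem mean_add (p : PMF α) (f g : α → ℝ) :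
    p.mean (fun x => f x + g x) = p.mean f + p.mean g := by
  simp [mean, mul_add, Finset.sum_add_distrib]

theorem mean_sub (p : PMF α) (f g : α → ℝ) :
    p.mean (fun x => f x - g x) = p.mean f - p.mean g := by
  simp [mean, mul_sub, Finset.sum_sub_distrib]

theorem mean_mono (p : PMF α) {f g : α → ℝ} (h : ∀ x, f x ≤ g x) : p.mean f ≤ p.mean g :=
  Finset.sum_le_sum fun x _ => mul_le_mul_of_nonneg_left (h x) ENNReal.toReal_nonneg

theorem mean_lt_mean {p : PMF α} {f g : α → ℝ} (h : ∀ x, f x ≤ g x) {x : α} (hp : p x ≠ 0)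
    (hx : f x < g x) : p.mean f < p.mean g :=
  Finset.sum_lt_sum (fun x _ => mul_le_mul_of_nonneg_left (h x) ENNReal.toReal_nonneg)
    ⟨x, Finset.mem_univ x, mul_lt_mul_of_pos_left hx (toReal_apply_pos hp)⟩

theorem mul_le_mean (p : PMF α) {f : α → ℝ} (h : ∀ x, 0 ≤ f x) (x : α) :
    (p x).toReal * f x ≤ p.mean f :=
  Finset.single_le_sum (f := fun x => (p x).toReal * f x)
    (fun x _ => mul_nonneg ENNReal.toReal_nonneg (h x)) (Finset.mem_univ x)

theorem mean_nonneg (p : PMF α) {f : α → ℝ} (h : ∀ x, 0 ≤ f x) : 0 ≤ p.mean f :=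
  Finset.sum_nonneg fun x _ => mul_nonneg ENNReal.toReal_nonneg (h x)

theorem abs_mean_le (p : PMF α) {f : α → ℝ} {C : ℝ} (h : ∀ x, |f x| ≤ C) : |p.mean f| ≤ C := by
  rw [abs_le]
  constructor
  · rw [← p.mean_const (-C)]
    exact p.mean_mono fun x => (abs_le.1 (h x)).1
  · rw [← p.mean_const C]
    exact p.mean_mono fun x => (abs_le.1 (h x)).2

theorem mean_pure (a : α) (f : α → ℝ) : (PMF.pure a).mean f = f a := by
  classical
  rw [mean, Finset.sum_eq_single a]
  · simp [PMF.pure_apply]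
  · intro b _ hb
    simp [PMF.pure_apply, hb]
  · simp

theorem mean_bind [Fintype β] (p : PMF α) (q : α → PMF β) (f : β → ℝ) :
    (p.bind q).mean f = p.mean fun x => (q x).mean f := by
  have key (b : β) : ((p.bind q) b).toReal = ∑ x, (p x).toReal * (q x b).toReal := by
    rw [PMF.bind_apply, tsum_fintype, ENNReal.toReal_sum]
    · simp [ENNReal.toReal_mul]
    · exact fun x _ => ENNReal.mul_ne_top (p.apply_ne_top x) ((q x).apply_ne_top b)
  simp only [mean, key, Finset.sum_mul, Finset.mul_sum]
  rw [Finset.sum_comm]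
  simp only [mul_assoc]

end PMF

/-! ### Shortest-path distance. -/

namespace WeightedDigraph

variable {V : Type*} {G : WeightedDigraph V}

namespace Walk

/-- Concatenation of walks. -/
def append : ∀ {u v w : V}, G.Walk u v → G.Walk v w → G.Walk u w
  | _, _, _, nil _, q => q
  | _, _, _, cons h p, q => cons h (p.append q)

theorem length_append {u v w : V} (p : G.Walk u v) (q : G.Walk v w) :
    (p.append q).length = p.length + q.length := by
  induction p with
  | nil v => simp [append, length]
  | cons h p ih => simp [append, length, ih, add_assoc]

theorem length_nonneg {u v : V} (p : G.Walk u v) : 0 ≤ p.length := by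
  induction p with
  | nil v => simp [length]
  | cons h p ih => exact add_nonneg (G.len_pos _ _ h).le ih

theorem exists_length_eq_add {u w x : V} (p : G.Walk u w) (hx : x ∈ p.support) :
    ∃ (q : G.Walk u x) (r : G.Walk x w), p.length = q.length + r.length := by
  induction p with
  | nil v =>
    obtain rfl : x = v := by simpa [support] using hx
    exact ⟨nil x, nil x, by simp [length]⟩
  | @cons a b c h p ih =>
    rw [support, List.mem_cons] at hx
    rcases hx with rfl | hx
    · exact ⟨nil x, cons h p, by simp [length]⟩
    · obtain ⟨q, r, e⟩ := ih hx
      exact ⟨cons h q, r, by simp [length, e, add_assoc]⟩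

end Walk

theorem bddBelow_range_length (u v : V) :
    BddBelow (Set.range fun p : G.Walk u v => p.length) :=
  ⟨0, by rintro _ ⟨p, rfl⟩; exact p.length_nonneg⟩

theorem dist_le_length {u v : V} (p : G.Walk u v) : G.dist u v ≤ p.length :=
  ciInf_le (bddBelow_range_length u v) p

theorem dist_nonneg (u v : V) : 0 ≤ G.dist u v :=
  Real.iInf_nonneg fun p => p.length_nonneg

theorem dist_self (v : V) : G.dist v v = 0 :=
  le_antisymm (dist_le_length (.nil v)) (dist_nonneg v v)

theorem StronglyConnected.dist_triangle (hG : G.StronglyConnected) (u v w : V) :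
    G.dist u w ≤ G.dist u v + G.dist v w := by
  have := hG u v
  have := hG v w
  refine le_ciInf_add_ciInf fun p q => ?_
  rw [← Walk.length_append]
  exact dist_le_length _

/-- A walk between distinct vertices uses an arc, and finitely many arcs have a positive minimal
length; this bounds the infimum away from zero. -/
theorem StronglyConnected.dist_pos [Finite V] (hG : G.StronglyConnected) {u v : V} (h : u ≠ v) :
    0 < G.dist u v := by
  have := Fintype.ofFinite V
  classical
  obtain ⟨ε, hε, hlen⟩ : ∃ ε > 0, ∀ a b, G.Adj a b → ε ≤ G.len a b := by
    have : Nonempty (V × V) := ⟨(u, v)⟩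
    -- The value 1 on non-arcs keeps the minimum over all pairs positive.
    obtain ⟨x, hx⟩ := Finite.exists_min fun e : V × V => if G.Adj e.1 e.2 then G.len e.1 e.2 else 1
    refine ⟨_, ?_, fun a b hab => (hx (a, b)).trans (by simp [hab])⟩
    split_ifs with hadj
    · exact G.len_pos _ _ hadj
    · exact one_pos
  have := hG u v
  refine hε.trans_le (le_ciInf fun p => ?_)
  cases p with
  | nil => exact absurd rfl h
  | cons hadj p => exact (hlen _ _ hadj).trans (le_add_of_nonneg_right p.length_nonneg)

theorem StronglyConnected.dist_add_dist_le (hG : G.StronglyConnected) {u v w : V} {p : G.Walk u w}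
    (hp : p.IsShortest) (hv : v ∈ p.support) : G.dist u v + G.dist v w ≤ G.dist u w := by
  have := hG u w
  obtain ⟨q, r, e⟩ := p.exists_length_eq_add hv
  calc G.dist u v + G.dist v w ≤ p.length := by
        rw [e]; exact add_le_add (dist_le_length q) (dist_le_length r)
    _ ≤ G.dist u w := le_ciInf hp

end WeightedDigraph

theorem Finset.inf'_univ_le_inf'_univ_add {ι κ : Type*} [Fintype ι] [Nonempty ι] [Fintype κ]
    [Nonempty κ] {f : ι → ℝ} {g : κ → ℝ} {c : ℝ} (h : ∀ k, ∃ j, f j ≤ g k + c) :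
    Finset.univ.inf' Finset.univ_nonempty f ≤ Finset.univ.inf' Finset.univ_nonempty g + c := by
  obtain ⟨k, -, hk⟩ := Finset.exists_mem_eq_inf' Finset.univ_nonempty g
  obtain ⟨j, hj⟩ := h k
  rw [hk]
  exact (Finset.inf'_le f (Finset.mem_univ j)).trans hj

/-! ### Regular functions and the optimality equation. -/

namespace AssignmentPolicy

variable {V : Type*} {N : ℕ}

/-- A service cost: a not necessarily symmetric distance. -/
structure IsServiceCost (d : V → V → ℝ) : Prop where
  self : ∀ v, d v v = 0
  pos : ∀ v w, v ≠ w → 0 < d v w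
  triangle : ∀ u v w, d u w ≤ d u v + d v w

theorem IsServiceCost.nonneg {d : V → V → ℝ} (hd : IsServiceCost d) (v w : V) : 0 ≤ d v w := by
  by_cases h : v = w
  · rw [h, hd.self]
  · exact (hd.pos v w h).le

/-- A function of the vehicle positions that does not depend on the labels of the vehicles and
varies by at most the service cost when one vehicle is moved. -/
structure IsRegular (d : V → V → ℝ) (h : (Fin N → V) → ℝ) : Prop where
  comp_perm : ∀ (s : Fin N → V) (σ : Equiv.Perm (Fin N)), h (s ∘ σ) = h s
  update_le : ∀ (s : Fin N → V) (k : Fin N) (a b : V),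
    h (Function.update s k a) ≤ h (Function.update s k b) + d a b

theorem isRegular_zero {d : V → V → ℝ} (hd : IsServiceCost d) :
    IsRegular d (0 : (Fin N → V) → ℝ) :=
  ⟨fun _ _ => rfl, fun s k a b => by simpa using hd.nonneg a b⟩

theorem IsRegular.smul {d : V → V → ℝ} (hd : IsServiceCost d) {h : (Fin N → V) → ℝ}
    (hh : IsRegular d h) {α : ℝ} (h0 : 0 ≤ α) (h1 : α ≤ 1) : IsRegular d (α • h) := by
  refine ⟨fun s σ => by simp [hh.comp_perm s σ], fun s k a b => ?_⟩
  have := mul_le_mul_of_nonneg_left (hh.update_le s k a b) h0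
  have := mul_le_of_le_one_left (hd.nonneg a b) h1
  simp only [Pi.smul_apply, smul_eq_mul]
  linarith

theorem IsRegular.sub_const {d : V → V → ℝ} {h : (Fin N → V) → ℝ}
    (hh : IsRegular d h) (c : ℝ) : IsRegular d (fun s => h s - c) :=
  ⟨fun s σ => by rw [hh.comp_perm s σ], fun s k a b => by linarith [hh.update_le s k a b]⟩

theorem isClosed_setOf_isRegular (d : V → V → ℝ) :
    IsClosed {h : (Fin N → V) → ℝ | IsRegular d h} := by
  have : {h : (Fin N → V) → ℝ | IsRegular d h} =
      {h | ∀ (s : Fin N → V) (σ : Equiv.Perm (Fin N)), h (s ∘ σ) = h s} ∩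
      {h | ∀ (s : Fin N → V) (k : Fin N) (a b : V),
        h (Function.update s k a) ≤ h (Function.update s k b) + d a b} := by
    ext h
    exact ⟨fun ⟨h₁, h₂⟩ => ⟨h₁, h₂⟩, fun ⟨h₁, h₂⟩ => ⟨h₁, h₂⟩⟩
  rw [this]
  refine IsClosed.inter ?_ ?_
  · simp only [Set.ofPred_forall]
    exact isClosed_iInter fun s => isClosed_iInter fun σ =>
      isClosed_eq (continuous_apply _) (continuous_apply _)
  · simp only [Set.ofPred_forall]
    exact isClosed_iInter fun s => isClosed_iInter fun k => isClosed_iInter fun a =>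
      isClosed_iInter fun b =>
        isClosed_le (continuous_apply _) ((continuous_apply _).add continuous_const)

/-- Exchanging the positions of two vehicles. -/
theorem IsRegular.update_update_swap {d : V → V → ℝ} {h : (Fin N → V) → ℝ} (hh : IsRegular d h)
    (s : Fin N → V) {j k : Fin N} (hjk : j ≠ k) (a b : V) :
    h (Function.update (Function.update s j a) k b) =
      h (Function.update (Function.update s j b) k a) := by
  rw [← hh.comp_perm (Function.update (Function.update s j b) k a) (Equiv.swap j k)]
  congr 1
  ext i
  simp only [Function.comp_apply, Function.update_apply, Equiv.swap_apply_def]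
  grind

variable [Fintype V]

/-- Move the vehicles one at a time. The crude bound does not depend on `h`, which gives compactness
as the discount factor tends to 1. -/
theorem IsRegular.sub_le {d : V → V → ℝ} {h : (Fin N → V) → ℝ} (hd : IsServiceCost d)
    (hh : IsRegular d h) (s t : Fin N → V) :
    h t - h s ≤ N * ∑ a, ∑ b, d a b := by
  classical
  have key (S : Finset (Fin N)) : h (S.piecewise t s) ≤ h s + S.card * ∑ a, ∑ b, d a b := by
    induction S using Finset.induction_on with
    | empty => simp
    | insert j S hj ih =>
      rw [Finset.piecewise_insert, Finset.card_insert_of_notMem hj]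
      have h₁ := hh.update_le (S.piecewise t s) j (t j) (S.piecewise t s j)
      rw [Function.update_eq_self] at h₁
      have h₂ : d (t j) (S.piecewise t s j) ≤ ∑ a, ∑ b, d a b :=
        (Finset.single_le_sum (f := fun b => d (t j) b) (fun b _ => hd.nonneg _ b)
          (Finset.mem_univ _)).trans
        (Finset.single_le_sum (f := fun a => ∑ b, d a b)
          (fun a _ => Finset.sum_nonneg fun b _ => hd.nonneg a b) (Finset.mem_univ _))
      push_cast
      linarith
  have := key Finset.univ
  rw [Finset.piecewise_univ, Finset.card_univ, Fintype.card_fin] at this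
  linarith

/-- The cost of assigning vehicle `k` to the user `u` in state `s`, if `h` is the cost of the
following state. -/
noncomputable def assignCost (d : V → V → ℝ) (P : PMF V) (h : (Fin N → V) → ℝ) (s : Fin N → V)
    (u : V) (k : Fin N) : ℝ :=
  d (s k) u + P.mean fun y => h (Function.update s k y)

/-- If the displaced vehicle is sent, the next state is the same and the triangle inequality
suffices; otherwise the displacement persists and regularity of `h` applies. -/
theorem assignCost_le_assignCost_update {d : V → V → ℝ} (hd : IsServiceCost d) (P : PMF V)
    {h : (Fin N → V) → ℝ} (hh : IsRegular d h) (s : Fin N → V) (k : Fin N) (a b u : V)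
    (j : Fin N) :
    assignCost d P h (Function.update s k a) u j ≤
      assignCost d P h (Function.update s k b) u j + d a b := by
  unfold assignCost
  by_cases hj : j = k
  · subst hj
    simp only [Function.update_self, Function.update_idem]
    linarith [hd.triangle a b u]
  · simp only [Function.update_of_ne hj]
    rw [add_assoc, ← P.mean_const (d a b), ← PMF.mean_add]
    refine add_le_add_right (P.mean_mono fun y => ?_) _
    rw [Function.update_comm (Ne.symm hj), Function.update_comm (Ne.symm hj)]
    exact hh.update_le _ k a b

variable [Nonempty (Fin N)]

/-- The least cost of an assignment. -/
noncomputable def minCost (d : V → V → ℝ) (P : PMF V) (h : (Fin N → V) → ℝ) (s : Fin N → V)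
    (u : V) : ℝ :=
  Finset.univ.inf' Finset.univ_nonempty (assignCost d P h s u)

/-- The Bellman operator of the assignment problem. -/
noncomputable def bellman (d : V → V → ℝ) (Q P : PMF V) (h : (Fin N → V) → ℝ) (s : Fin N → V) : ℝ :=
  Q.mean (minCost d P h s)

theorem minCost_le (d : V → V → ℝ) (P : PMF V) (h : (Fin N → V) → ℝ) (s : Fin N → V) (u : V)
    (k : Fin N) : minCost d P h s u ≤ assignCost d P h s u k :=
  Finset.inf'_le _ (Finset.mem_univ k)

theorem exists_minCost_eq (d : V → V → ℝ) (P : PMF V) (h : (Fin N → V) → ℝ) (s : Fin N → V)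
    (u : V) : ∃ k, minCost d P h s u = assignCost d P h s u k := by
  obtain ⟨k, -, hk⟩ := Finset.exists_mem_eq_inf' Finset.univ_nonempty (assignCost d P h s u)
  exact ⟨k, hk⟩

theorem bellman_le_add {d : V → V → ℝ} {Q P : PMF V} {h h' : (Fin N → V) → ℝ} {c : ℝ}
    (hc : ∀ s, h s ≤ h' s + c) (s : Fin N → V) :
    bellman d Q P h s ≤ bellman d Q P h' s + c := by
  rw [bellman, bellman, ← Q.mean_const c, ← PMF.mean_add]
  refine Q.mean_mono fun u => ?_
  refine Finset.inf'_univ_le_inf'_univ_add fun k => ⟨k, ?_⟩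
  rw [assignCost, assignCost, add_assoc, ← P.mean_const c, ← PMF.mean_add]
  refine add_le_add_right (P.mean_mono fun y => ?_) _
  exact hc _

theorem bellman_add_const (d : V → V → ℝ) (Q P : PMF V) (h : (Fin N → V) → ℝ) (c : ℝ)
    (s : Fin N → V) : bellman d Q P (fun s => h s + c) s = bellman d Q P h s + c := by
  refine le_antisymm (bellman_le_add (fun _ => le_rfl) s) ?_
  have := bellman_le_add (d := d) (Q := Q) (P := P) (h := h) (h' := fun s => h s + c) (c := -c)
    (fun s => by simp) s
  linarith

theorem dist_bellman_le (d : V → V → ℝ) (Q P : PMF V) (h h' : (Fin N → V) → ℝ) :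
    dist (bellman d Q P h) (bellman d Q P h') ≤ dist h h' := by
  have key (h h' : (Fin N → V) → ℝ) (s : Fin N → V) : h s ≤ h' s + dist h h' := by
    have := (le_abs_self _).trans ((Real.dist_eq _ _).symm.le.trans (dist_le_pi_dist h h' s))
    linarith
  refine (dist_pi_le_iff dist_nonneg).2 fun s => ?_
  rw [Real.dist_eq, abs_le]
  have h₁ := bellman_le_add (d := d) (Q := Q) (P := P) (key h h') s
  have h₂ := bellman_le_add (d := d) (Q := Q) (P := P) (key h' h) s
  rw [dist_comm h' h] at h₂
  constructor <;> linarith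

theorem continuous_bellman (d : V → V → ℝ) (Q P : PMF V) :
    Continuous (bellman (N := N) d Q P) :=
  (LipschitzWith.of_dist_le_mul (K := 1) fun h h' => by
    simpa using dist_bellman_le d Q P h h').continuous

theorem IsRegular.bellman {d : V → V → ℝ} (hd : IsServiceCost d) (Q P : PMF V)
    {h : (Fin N → V) → ℝ} (hh : IsRegular d h) : IsRegular d (bellman d Q P h) := by
  refine ⟨fun s σ => ?_, fun s k a b => ?_⟩
  · have key (u : V) (k : Fin N) : assignCost d P h (s ∘ σ) u k = assignCost d P h s u (σ k) := by
      simp only [assignCost, Function.comp_apply]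
      congr 2
      ext y
      rw [← hh.comp_perm (Function.update s (σ k) y) σ, Function.update_comp_equiv,
        Equiv.symm_apply_apply]
    unfold AssignmentPolicy.bellman
    congr 1
    ext u
    obtain ⟨k, hk⟩ := exists_minCost_eq d P h s u
    obtain ⟨j, hj⟩ := exists_minCost_eq d P h (s ∘ σ) u
    refine le_antisymm ?_ ?_
    · have := minCost_le d P h (s ∘ σ) u (σ.symm k)
      rwa [key, Equiv.apply_symm_apply, ← hk] at this
    · rw [hj, key]
      exact minCost_le d P h s u (σ j)
  · rw [AssignmentPolicy.bellman, AssignmentPolicy.bellman, ← Q.mean_const (d a b), ← PMF.mean_add]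
    refine Q.mean_mono fun u => ?_
    exact Finset.inf'_univ_le_inf'_univ_add fun j =>
      ⟨j, assignCost_le_assignCost_update hd P hh s k a b u j⟩

/-- The discounted optimality equation, for relative values. -/
theorem exists_discounted_solution {d : V → V → ℝ} (hd : IsServiceCost d) (Q P : PMF V)
    (s₀ : Fin N → V) {α : ℝ} (h0 : 0 ≤ α) (h1 : α < 1) :
    ∃ h : (Fin N → V) → ℝ, IsRegular d h ∧ h s₀ = 0 ∧
      ∀ s, h s = bellman d Q P (α • h) s - bellman d Q P (α • h) s₀ := by
  lift α to NNReal using h0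
  have hmaps : Set.MapsTo (fun h : (Fin N → V) → ℝ => bellman d Q P ((α : ℝ) • h))
      {h | IsRegular d h} {h | IsRegular d h} := fun h hh =>
    (IsRegular.smul hd hh α.2 h1.le).bellman hd Q P
  have hcontr : ContractingWith α (hmaps.restrict _ _ _) := by
    refine ⟨by exact_mod_cast h1, LipschitzWith.of_dist_le_mul fun x y => ?_⟩
    refine (dist_bellman_le d Q P _ _).trans ?_
    rw [dist_smul₀, Real.norm_of_nonneg α.coe_nonneg]
    rfl
  obtain ⟨v, hv, hfix, -⟩ := hcontr.exists_fixedPoint' (isClosed_setOf_isRegular d).isComplete hmaps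
    (isRegular_zero hd) (edist_ne_top _ _)
  have hfix' (s : Fin N → V) : bellman d Q P ((α : ℝ) • v) s = v s := congrFun hfix s
  -- Normalising the value at `s₀` shifts the argument by the constant `α * v s₀`, which passes
  -- through the operator.
  have hrel (s : Fin N → V) :
      v s = bellman d Q P ((α : ℝ) • fun s => v s - v s₀) s + α * v s₀ := by
    rw [← bellman_add_const]
    nth_rw 1 [← hfix' s]
    congr 1
    ext t
    simp only [Pi.smul_apply, smul_eq_mul]
    ring
  refine ⟨fun s => v s - v s₀, IsRegular.sub_const hv _, sub_self _, fun s => ?_⟩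
  linarith [hrel s, hrel s₀]

/-- The average cost optimality equation. -/
theorem exists_averageCost_solution {d : V → V → ℝ} (hd : IsServiceCost d) (Q P : PMF V)
    (s₀ : Fin N → V) :
    ∃ (h : (Fin N → V) → ℝ) (g : ℝ), IsRegular d h ∧ ∀ s, bellman d Q P h s = h s + g := by
  let α : ℕ → ℝ := fun n => 1 - 1 / ((n : ℝ) + 1)
  have hα0 (n : ℕ) : 0 ≤ α n := sub_nonneg.2 (div_le_one_of_le₀ (by simp) (by positivity))
  have hα1 (n : ℕ) : α n < 1 := sub_lt_self _ (by positivity)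
  have hα : Tendsto α atTop (𝓝 1) := by
    simpa [α] using tendsto_const_nhds.sub (tendsto_one_div_add_atTop_nhds_zero_nat (𝕜 := ℝ))
  choose h hreg hzero heq using fun n => exists_discounted_solution hd Q P s₀ (hα0 n) (hα1 n)
  have hbound (n : ℕ) : h n ∈ Metric.closedBall 0 (N * ∑ a, ∑ b, d a b) := by
    have hC : 0 ≤ N * ∑ a, ∑ b, d a b :=
      mul_nonneg N.cast_nonneg
        (Finset.sum_nonneg fun a _ => Finset.sum_nonneg fun b _ => hd.nonneg a b)
    rw [mem_closedBall_zero_iff, pi_norm_le_iff_of_nonneg hC]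
    intro s
    rw [Real.norm_eq_abs, abs_le]
    have h₁ := (hreg n).sub_le hd s s₀
    have h₂ := (hreg n).sub_le hd s₀ s
    rw [hzero n] at h₁ h₂
    constructor <;> linarith
  -- Vanishing discount: the bound is uniform in `n`, so a subsequence converges, and continuity
  -- carries the equation to the limit.
  obtain ⟨h', -, φ, hφ, hlim⟩ := (isCompact_closedBall _ _).tendsto_subseq hbound
  have hT : Tendsto (fun n => bellman d Q P (α (φ n) • h (φ n))) atTop (𝓝 (bellman d Q P h')) := by
    refine ((continuous_bellman d Q P).tendsto h').comp ?_
    simpa using (hα.comp hφ.tendsto_atTop).smul hlim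
  refine ⟨h', bellman d Q P h' s₀, (isClosed_setOf_isRegular d).mem_of_tendsto hlim
    (Eventually.of_forall fun n => hreg (φ n)), fun s => ?_⟩
  have hs := tendsto_nhds_unique ((tendsto_pi_nhds.1 hlim s).congr fun n => heq (φ n) s)
    ((tendsto_pi_nhds.1 hT s).sub (tendsto_pi_nhds.1 hT s₀))
  linarith

/-- A solution of the optimality equation varies by strictly less than the service cost when one
vehicle is moved. -/
theorem IsRegular.update_lt {d : V → V → ℝ} (hd : IsServiceCost d) {Q P : PMF V}
    (hQ : ∀ v, Q v ≠ 0) (hP : ∀ v, P v ≠ 0) {h : (Fin N → V) → ℝ} {g : ℝ} (hh : IsRegular d h)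
    (hsol : ∀ s, AssignmentPolicy.bellman d Q P h s = h s + g) (s : Fin N → V) (k : Fin N)
    {a b : V} (hab : a ≠ b) :
    h (Function.update s k a) < h (Function.update s k b) + d a b := by
  classical
  -- Induction on the number of other vehicles not at `b`. By the optimality equation, strictness
  -- for a user at `a` suffices, since `Q a` is positive.
  induction hn : (Finset.univ.filter fun i => i ≠ k ∧ s i ≠ b).card using Nat.strong_induction_on
    generalizing s with
  | _ n ih =>
  suffices hlt : minCost d P h (Function.update s k a) a <
      minCost d P h (Function.update s k b) a + d a b by
    have hmean := PMF.mean_lt_mean (p := Q) (f := minCost d P h (Function.update s k a))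
      (g := fun u => minCost d P h (Function.update s k b) u + d a b) (fun u =>
        Finset.inf'_univ_le_inf'_univ_add fun j =>
          ⟨j, assignCost_le_assignCost_update hd P hh s k a b u j⟩) (hQ a) hlt
    rw [PMF.mean_add, Q.mean_const] at hmean
    have h₁ := hsol (Function.update s k a)
    have h₂ := hsol (Function.update s k b)
    rw [AssignmentPolicy.bellman] at h₁ h₂
    linarith
  obtain ⟨j, hj⟩ := exists_minCost_eq d P h (Function.update s k b) a
  rw [hj]
  have hpos : 0 < d b a + d a b := add_pos (hd.pos _ _ hab.symm) (hd.pos _ _ hab)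
  by_cases hjk : j = k
  · subst hjk
    refine (minCost_le d P h _ a j).trans_lt ?_
    simp only [assignCost, Function.update_self, Function.update_idem, hd.self]
    linarith
  -- Sending `k` from `a` for free and sending `j` from `b` lead to the same state up to labels, so
  -- the difference is at least `d b a`.
  by_cases hjb : s j = b
  · refine (minCost_le d P h _ a k).trans_lt ?_
    simp only [assignCost, Function.update_self, Function.update_idem, hd.self,
      Function.update_of_ne hjk, hjb]
    have hswap (y : V) : h (Function.update (Function.update s k b) j y) =
        h (Function.update s k y) := by
      rw [hh.update_update_swap s (Ne.symm hjk), ← hjb,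
        Function.update_comm (Ne.symm hjk), Function.update_eq_self]
    simp only [hswap]
    linarith
  · refine (minCost_le d P h _ a j).trans_lt ?_
    simp only [assignCost, Function.update_of_ne hjk]
    rw [add_assoc, ← P.mean_const (d a b), ← PMF.mean_add]
    refine add_lt_add_right (PMF.mean_lt_mean (fun y => ?_) (hP b) ?_) _
    · rw [Function.update_comm (Ne.symm hjk), Function.update_comm (Ne.symm hjk)]
      exact hh.update_le _ k a b
    · rw [Function.update_comm (Ne.symm hjk), Function.update_comm (Ne.symm hjk)]
      -- The replacement lands at `b` with positive probability, and then one vehicle fewer is away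
      -- from `b`.
      refine ih _ ?_ _ rfl
      rw [← hn]
      refine Finset.card_lt_card (Finset.ssubset_iff_of_subset ?_ |>.2 ⟨j, ?_, ?_⟩)
      · intro i
        simp only [Finset.mem_filter, Finset.mem_univ, true_and]
        rintro ⟨hik, hib⟩
        refine ⟨hik, fun hi => hib ?_⟩
        by_cases hij : i = j
        · rw [hij, Function.update_self]
        · rwa [Function.update_of_ne hij]
      · simp [hjk, hjb]
      · simp

/-- Sending a vehicle past an occupied position is not optimal. -/
theorem IsRegular.minCost_lt_assignCost {d : V → V → ℝ} (hd : IsServiceCost d) {Q P : PMF V}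
    (hQ : ∀ v, Q v ≠ 0) (hP : ∀ v, P v ≠ 0) {h : (Fin N → V) → ℝ} {g : ℝ} (hh : IsRegular d h)
    (hsol : ∀ s, AssignmentPolicy.bellman d Q P h s = h s + g) {s : Fin N → V} {u : V}
    {j k : Fin N} (hne : s j ≠ s k) (hpath : d (s k) (s j) + d (s j) u ≤ d (s k) u) :
    minCost d P h s u < assignCost d P h s u k := by
  have hjk : j ≠ k := fun e => hne (by rw [e])
  refine (minCost_le d P h s u j).trans_lt ?_
  have hlt : P.mean (fun y => h (Function.update s j y)) <
      P.mean fun y => h (Function.update s k y) + d (s k) (s j) := by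
    -- Up to labels, the two next states differ only in whether the remaining vehicle stands at `s
    -- k` or at `s j`.
    have key (y : V) :
        h (Function.update s j y) < h (Function.update s k y) + d (s k) (s j) := by
      have h₁ : Function.update s j y =
          Function.update (Function.update s j y) k (s k) := by
        rw [Function.update_comm hjk, Function.update_eq_self]
      have h₂ : Function.update s k y =
          Function.update (Function.update s k y) j (s j) := by
        rw [Function.update_comm (Ne.symm hjk), Function.update_eq_self]
      rw [h₁, hh.update_update_swap s hjk, Function.update_comm hjk, h₂]
      simp only [Function.update_idem]
      exact hh.update_lt hd hQ hP hsol _ j (Ne.symm hne)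
    exact PMF.mean_lt_mean (fun y => (key y).le) (hP u) (key u)
  rw [PMF.mean_add, P.mean_const] at hlt
  unfold assignCost
  linarith

end AssignmentPolicy

/-! ### Average loss and null states. -/

namespace AssignmentPolicy

variable {V : Type*} {N : ℕ}

/-- The long-run frequency of the state `s` is zero. -/
def IsNull (Q P : PMF V) (ρ : AssignmentPolicy V N) (s₁ s : Fin N → V) : Prop :=
  Tendsto (fun T : ℕ => (∑ t ∈ Finset.range T, (law Q P ρ s₁ t s).toReal) / (T : ℝ)) atTop (𝓝 0)

theorem isNull_of_le_mul {Q P : PMF V} {ρ : AssignmentPolicy V N} {s₁ s : Fin N → V}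
    {f : ℕ → ℝ} {ε : ℝ} (hε : 0 < ε) (hle : ∀ t, (law Q P ρ s₁ t s).toReal * ε ≤ f t)
    (hf : Tendsto (fun T : ℕ => (∑ t ∈ Finset.range T, f t) / (T : ℝ)) atTop (𝓝 0)) :
    IsNull Q P ρ s₁ s := by
  have hf' := hf.div_const ε
  rw [zero_div] at hf'
  refine squeeze_zero (fun T => ?_) (fun T => ?_) hf'
  · exact div_nonneg (Finset.sum_nonneg fun t _ => ENNReal.toReal_nonneg) T.cast_nonneg
  · rw [le_div_iff₀ hε, div_mul_eq_mul_div, Finset.sum_mul]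
    exact div_le_div_of_nonneg_right (Finset.sum_le_sum fun t _ => hle t) T.cast_nonneg

variable [Fintype V]

theorem mean_step (Q P : PMF V) (ρ : AssignmentPolicy V N) (s : Fin N → V)
    (f : (Fin N → V) → ℝ) :
    (step Q P ρ s).mean f = Q.mean fun u => P.mean fun y => f (Function.update s (ρ s u) y) := by
  simp only [step, PMF.mean_bind, PMF.mean_pure]

theorem mean_law_succ (Q P : PMF V) (ρ : AssignmentPolicy V N) (s₁ : Fin N → V) (t : ℕ)
    (f : (Fin N → V) → ℝ) :
    (law Q P ρ s₁ (t + 1)).mean f = (law Q P ρ s₁ t).mean fun s => (step Q P ρ s).mean f := by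
  rw [law, PMF.mean_bind]

theorem mean_law_zero (Q P : PMF V) (ρ : AssignmentPolicy V N) (s₁ : Fin N → V)
    (f : (Fin N → V) → ℝ) : (law Q P ρ s₁ 0).mean f = f s₁ := by
  rw [law, PMF.mean_pure]

section Gap

variable [Nonempty (Fin N)]

/-- The expected loss of the decision of a policy against the best assignment. -/
noncomputable def gap (d : V → V → ℝ) (Q P : PMF V) (h : (Fin N → V) → ℝ)
    (ρ : AssignmentPolicy V N) (s : Fin N → V) : ℝ :=
  Q.mean fun u => assignCost d P h s u (ρ s u) - minCost d P h s u

theorem gap_nonneg (d : V → V → ℝ) (Q P : PMF V) (h : (Fin N → V) → ℝ)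
    (ρ : AssignmentPolicy V N) (s : Fin N → V) : 0 ≤ gap d Q P h ρ s :=
  Q.mean_nonneg fun u => sub_nonneg.2 (minCost_le d P h s u _)

theorem gap_pos {d : V → V → ℝ} {Q : PMF V} {P : PMF V} {h : (Fin N → V) → ℝ}
    {ρ : AssignmentPolicy V N} {s : Fin N → V} {u : V} (hu : Q u ≠ 0)
    (hlt : minCost d P h s u < assignCost d P h s u (ρ s u)) : 0 < gap d Q P h ρ s :=
  (mul_pos (PMF.toReal_apply_pos hu) (sub_pos.2 hlt)).trans_le
    (Q.mul_le_mean (f := fun u => assignCost d P h s u (ρ s u) - minCost d P h s u)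
      (fun u => sub_nonneg.2 (minCost_le d P h s u _)) u)

/-- In expectation, the stage cost plus the next value of `h` is the loss plus the current value
plus `g`; the values of `h` telescope. -/
theorem sum_expectedCost {Q P : PMF V} {G : WeightedDigraph V} {h : (Fin N → V) → ℝ} {g : ℝ}
    (hsol : ∀ s, bellman G.dist Q P h s = h s + g) (ρ : AssignmentPolicy V N) (s₁ : Fin N → V)
    (T : ℕ) :
    ∑ t ∈ Finset.range T, expectedCost Q P G ρ s₁ t =
      (∑ t ∈ Finset.range T, (law Q P ρ s₁ t).mean (gap G.dist Q P h ρ)) + T * g +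
        (h s₁ - (law Q P ρ s₁ T).mean h) := by
  have hstep (s : Fin N → V) : (Q.mean fun u => G.dist (s (ρ s u)) u) + (step Q P ρ s).mean h =
      gap G.dist Q P h ρ s + h s + g := by
    have := hsol s
    rw [bellman] at this
    rw [mean_step, ← PMF.mean_add, gap, PMF.mean_sub, this]
    simp only [assignCost]
    ring
  have hcost (t : ℕ) : expectedCost Q P G ρ s₁ t + (law Q P ρ s₁ (t + 1)).mean h =
      (law Q P ρ s₁ t).mean (gap G.dist Q P h ρ) + (law Q P ρ s₁ t).mean h + g := by
    have : expectedCost Q P G ρ s₁ t =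
        (law Q P ρ s₁ t).mean fun s => Q.mean fun u => G.dist (s (ρ s u)) u := rfl
    rw [this, mean_law_succ, ← PMF.mean_add]
    simp only [hstep, PMF.mean_add, PMF.mean_const]
  induction T with
  | zero => simp [mean_law_zero]
  | succ T ih =>
    rw [Finset.sum_range_succ, Finset.sum_range_succ, ih]
    push_cast
    linarith [hcost T]

theorem hasAverageCost_iff_tendsto_gap {Q P : PMF V} {G : WeightedDigraph V}
    {h : (Fin N → V) → ℝ} {g : ℝ} (hsol : ∀ s, bellman G.dist Q P h s = h s + g)
    (ρ : AssignmentPolicy V N) (s₁ : Fin N → V) (c : ℝ) :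
    HasAverageCost Q P G ρ s₁ c ↔
      Tendsto (fun T : ℕ => (∑ t ∈ Finset.range T,
        (law Q P ρ s₁ t).mean (gap G.dist Q P h ρ)) / (T : ℝ)) atTop (𝓝 (c - g)) := by
  have hbdd : ∃ C, ∀ s, |h s| ≤ C := by
    obtain ⟨C, hC⟩ := (Set.finite_range fun s => |h s|).bddAbove
    exact ⟨C, fun s => hC ⟨s, rfl⟩⟩
  obtain ⟨C, hC⟩ := hbdd
  have hrem : Tendsto (fun T : ℕ => (h s₁ - (law Q P ρ s₁ T).mean h) / (T : ℝ)) atTop (𝓝 0) := by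
    refine squeeze_zero_norm (a := fun T : ℕ => (C + C) / (T : ℝ)) (fun T => ?_)
      (tendsto_const_div_atTop_nhds_zero_nat _)
    rw [norm_div, Real.norm_natCast]
    exact div_le_div_of_nonneg_right
      ((norm_sub_le _ _).trans (add_le_add (hC s₁) (PMF.abs_mean_le _ hC))) T.cast_nonneg
  have heq : ∀ᶠ T : ℕ in atTop,
      (∑ t ∈ Finset.range T, expectedCost Q P G ρ s₁ t) / (T : ℝ) =
      (∑ t ∈ Finset.range T, (law Q P ρ s₁ t).mean (gap G.dist Q P h ρ)) / (T : ℝ) + g +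
        (h s₁ - (law Q P ρ s₁ T).mean h) / (T : ℝ) := by
    filter_upwards [eventually_gt_atTop 0] with T hT
    have : (T : ℝ) ≠ 0 := by positivity
    rw [sum_expectedCost hsol]
    field_simp
  rw [HasAverageCost, tendsto_congr' heq]
  constructor <;> intro H
  · have := (H.sub hrem).sub_const g
    simpa using this
  · have := (H.add_const g).add hrem
    simpa using this

/-- An optimal policy has a vanishing average loss. -/
theorem IsOptimal.tendsto_gap {Q P : PMF V} {G : WeightedDigraph V}
    {h : (Fin N → V) → ℝ} {g : ℝ} (hsol : ∀ s, bellman G.dist Q P h s = h s + g)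
    {ρ : AssignmentPolicy V N} {s₁ : Fin N → V} (hρ : IsOptimal Q P G ρ s₁) :
    Tendsto (fun T : ℕ => (∑ t ∈ Finset.range T,
      (law Q P ρ s₁ t).mean (gap G.dist Q P h ρ)) / (T : ℝ)) atTop (𝓝 0) := by
  obtain ⟨c, hc, hmin⟩ := hρ
  -- The greedy policy has zero loss, so its average cost is `g`; nonnegative losses give `g ≤ c`.
  choose ρ' hρ' using exists_minCost_eq (N := N) G.dist P h
  have hgap : gap G.dist Q P h ρ' = fun _ => 0 := by
    ext s
    simp [gap, hρ', PMF.mean]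
  have hg : HasAverageCost Q P G ρ' s₁ g := by
    rw [hasAverageCost_iff_tendsto_gap hsol, hgap]
    simp [PMF.mean_const]
  have hlim := (hasAverageCost_iff_tendsto_gap hsol ρ s₁ c).1 hc
  have h0 : 0 ≤ c - g := ge_of_tendsto' hlim fun T => div_nonneg
    (Finset.sum_nonneg fun t _ => PMF.mean_nonneg _ (gap_nonneg _ _ _ _ _)) T.cast_nonneg
  have h1 := hmin ρ' g hg
  rwa [show c - g = 0 by linarith] at hlim

end Gap

/-- An optimal policy sends vehicles past occupied positions only in states of zero frequency. -/
theorem IsOptimal.isNull {G : WeightedDigraph V} (hG : G.StronglyConnected) {Q P : PMF V}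
    (hQ : ∀ v, Q v ≠ 0) (hP : ∀ v, P v ≠ 0) {s₁ : Fin N → V} {ρ : AssignmentPolicy V N}
    (hρ : IsOptimal Q P G ρ s₁) {s : Fin N → V} {u v : V} (hv : v ∈ Set.range s)
    (hne : v ≠ s (ρ s u))
    (hpath : G.dist (s (ρ s u)) v + G.dist v u ≤ G.dist (s (ρ s u)) u) :
    IsNull Q P ρ s₁ s := by
  obtain ⟨j, rfl⟩ := hv
  have : Nonempty (Fin N) := ⟨j⟩
  have hd : IsServiceCost G.dist := ⟨G.dist_self, fun _ _ => hG.dist_pos, hG.dist_triangle⟩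
  obtain ⟨h, g, hh, hsol⟩ := exists_averageCost_solution hd Q P s₁
  exact isNull_of_le_mul (gap_pos (hQ u) (hh.minCost_lt_assignCost hd hQ hP hsol hne hpath))
    (fun t => PMF.mul_le_mean _ (gap_nonneg _ _ _ _ _) s) (hρ.tendsto_gap hsol)

/-- The frequencies of the finitely many states sum to 1. -/
theorem exists_not_isNull (Q P : PMF V) (ρ : AssignmentPolicy V N) (s₁ : Fin N → V) :
    ∃ s, ¬ IsNull Q P ρ s₁ s := by
  by_contra! H
  have hsum := tendsto_finsetSum Finset.univ fun s _ => H s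
  rw [Finset.sum_const_zero] at hsum
  refine one_ne_zero (tendsto_nhds_unique (tendsto_const_nhds.congr' ?_) hsum)
  filter_upwards [eventually_gt_atTop 0] with T hT
  rw [← Finset.sum_div, Finset.sum_comm]
  simp only [PMF.sum_toReal]
  simp [hT.ne']

/-- The transition has probability at least `Q u * P y`; shifting time by one stage changes the
average by at most 1/T. -/
theorem not_isNull_update {Q P : PMF V} (hQ : ∀ v, Q v ≠ 0) (hP : ∀ v, P v ≠ 0)
    {ρ : AssignmentPolicy V N} {s₁ s : Fin N → V} (hs : ¬ IsNull Q P ρ s₁ s) (u y : V) :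
    ¬ IsNull Q P ρ s₁ (Function.update s (ρ s u) y) := by
  classical
  intro H
  set s' := Function.update s (ρ s u) y with hs'
  let f : (Fin N → V) → ℝ := Pi.single s' 1
  have hf (x : Fin N → V) : 0 ≤ f x := by
    simp only [f, Pi.single_apply]
    positivity
  have hfmean (p : PMF (Fin N → V)) : p.mean f = (p s').toReal := by
    simp [PMF.mean, f, Pi.single_apply]
  refine hs (isNull_of_le_mul (f := fun t => (law Q P ρ s₁ (t + 1) s').toReal)
    (mul_pos (PMF.toReal_apply_pos (hQ u)) (PMF.toReal_apply_pos (hP y))) (fun t => ?_) ?_)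
  · rw [← hfmean, mean_law_succ]
    refine le_trans ?_ (PMF.mul_le_mean _ (fun x => PMF.mean_nonneg _ hf) s)
    refine mul_le_mul_of_nonneg_left ?_ ENNReal.toReal_nonneg
    rw [mean_step]
    refine le_trans ?_ (Q.mul_le_mean (fun x => PMF.mean_nonneg _ fun y => hf _) u)
    refine mul_le_mul_of_nonneg_left ?_ ENNReal.toReal_nonneg
    refine le_trans ?_ (P.mul_le_mean (fun y => hf _) y)
    simp [f, ← hs']
  · refine squeeze_zero (g := fun T : ℕ =>
      (∑ t ∈ Finset.range T, (law Q P ρ s₁ t s').toReal) / (T : ℝ) + 1 / (T : ℝ))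
      (fun T => div_nonneg (Finset.sum_nonneg fun t _ => ENNReal.toReal_nonneg) T.cast_nonneg)
      (fun T => ?_) ?_
    · rw [← add_div]
      refine div_le_div_of_nonneg_right ?_ T.cast_nonneg
      have h₁ := Finset.sum_range_succ' (fun t => (law Q P ρ s₁ t s').toReal) T
      have h₂ := Finset.sum_range_succ (fun t => (law Q P ρ s₁ t s').toReal) T
      have h₃ : (law Q P ρ s₁ T s').toReal ≤ 1 :=
        ENNReal.toReal_le_of_le_ofReal zero_le_one (by simpa using PMF.coe_le_one _ _)
      have h₄ : 0 ≤ (law Q P ρ s₁ 0 s').toReal := ENNReal.toReal_nonneg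
      linarith
    · simpa using H.add (tendsto_const_div_atTop_nhds_zero_nat (1 : ℝ))

end AssignmentPolicy

/-! ### Reaching all states. -/

namespace AssignmentPolicy

variable {V : Type*} {N : ℕ}

/-- A set of vehicle positions from which, at every occupied position, some vehicle can be sent
away to an arbitrary place. -/
def IsMovable (R : Set (Fin N → V)) : Prop :=
  ∀ s ∈ R, ∀ j, ∃ k, s k = s j ∧ ∀ y, Function.update s k y ∈ R

/-- Up to relabelling, all vehicle positions are reached. -/
theorem IsMovable.exists_comp_perm_mem {R : Set (Fin N → V)} (hR : IsMovable R)
    (hne : R.Nonempty) (t : Fin N → V) : ∃ σ : Equiv.Perm (Fin N), t ∘ σ ∈ R := by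
  obtain ⟨s, hs⟩ := hne
  have hclosed (s : Fin N → V) (hs : ∃ σ : Equiv.Perm (Fin N), s ∘ σ ∈ R) (i : Fin N) (y : V) :
      ∃ σ : Equiv.Perm (Fin N), Function.update s i y ∘ σ ∈ R := by
    obtain ⟨σ, hσ⟩ := hs
    obtain ⟨k, hk, hmem⟩ := hR _ hσ (σ.symm i)
    simp only [Function.comp_apply, Equiv.apply_symm_apply] at hk
    -- The movable vehicle `σ k` shares the position of `i`, so the two can exchange labels.
    refine ⟨σ.trans (Equiv.swap i (σ k)), ?_⟩
    convert hmem y using 1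
    ext m
    have hinj : σ m = σ k → m = k := fun e => σ.injective e
    simp only [Function.comp_apply, Equiv.trans_apply, Function.update_apply,
      Equiv.swap_apply_def]
    grind
  have key (S : Finset (Fin N)) : ∃ σ : Equiv.Perm (Fin N), S.piecewise t s ∘ σ ∈ R := by
    induction S using Finset.induction_on with
    | empty => exact ⟨1, by simpa using hs⟩
    | insert j S _ ih =>
      rw [Finset.piecewise_insert]
      exact hclosed _ ih j (t j)
  simpa using key Finset.univ

theorem IsMovable.update_mem {R : Set (Fin N → V)} (hR : IsMovable R) {s : Fin N → V}
    (hs : s ∈ R) {k : Fin N} (hk : ∀ j, s j = s k → j = k) (y : V) :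
    Function.update s k y ∈ R := by
  obtain ⟨j, hj, hmem⟩ := hR s hs k
  exact hk j hj ▸ hmem y

/-- Park `i` at the vacant vertex, move `j` to the old place of `i`, then `i` to that of `j`; the
moving vehicle is always alone at its position. -/
theorem IsMovable.comp_swap_mem {R : Set (Fin N → V)} (hR : IsMovable R) {s : Fin N → V}
    (hs : s ∈ R) (hinj : Function.Injective s) {h : V} (hh : h ∉ Set.range s) (i j : Fin N) :
    s ∘ Equiv.swap i j ∈ R := by
  by_cases hij : i = j
  · simpa [hij] using hs
  have hh' (k : Fin N) : s k ≠ h := fun e => hh ⟨k, e⟩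
  have hinj' (a b : Fin N) : s a = s b → a = b := fun e => hinj e
  have h₁ : Function.update s i h ∈ R := hR.update_mem hs (fun k hk => hinj hk) h
  have h₂ : Function.update (Function.update s i h) j (s i) ∈ R := by
    refine hR.update_mem h₁ (fun k hk => ?_) _
    simp only [Function.update_apply] at hk
    grind
  have h₃ : Function.update (Function.update (Function.update s i h) j (s i)) i (s j) ∈ R := by
    refine hR.update_mem h₂ (fun k hk => ?_) _
    simp only [Function.update_apply] at hk
    grind
  convert h₃ using 1
  ext k
  simp only [Function.comp_apply, Function.update_apply, Equiv.swap_apply_def]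
  grind

variable [Fintype V]

/-- With fewer vehicles than vertices, all vehicle positions are reached. -/
theorem IsMovable.mem_of_card_lt {R : Set (Fin N → V)} (hR : IsMovable R)
    (hne : R.Nonempty) (hN : N < Fintype.card V) (t : Fin N → V) : t ∈ R := by
  classical
  have hole (t : Fin N → V) : ∃ h, h ∉ Set.range t := by
    by_contra! H
    have := Fintype.card_le_of_surjective t H
    rw [Fintype.card_fin] at this
    omega
  have hinjective (t : Fin N → V) (ht : Function.Injective t) : t ∈ R := by
    obtain ⟨σ, hσ⟩ := hR.exists_comp_perm_mem hne t
    have key (τ : Equiv.Perm (Fin N)) : (t ∘ σ) ∘ τ ∈ R := by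
      induction τ using Equiv.Perm.swap_induction_on' with
      | one => simpa using hσ
      | mul_swap τ i j _ ih =>
        obtain ⟨h, hh⟩ := hole ((t ∘ σ) ∘ τ)
        exact hR.comp_swap_mem ih ((ht.comp σ.injective).comp τ.injective) hh i j
    simpa [Function.comp_assoc] using key σ⁻¹
  induction hn : N - (Finset.univ.image t).card using Nat.strong_induction_on
    generalizing t with
  | _ n ih =>
  by_cases ht : Function.Injective t
  · exact hinjective t ht
  have hlt : (Finset.univ.image t).card < N := by
    refine lt_of_le_of_ne (by simpa using Finset.card_image_le (s := Finset.univ) (f := t)) ?_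
    intro e
    exact ht (Set.injOn_univ.1 (by simpa using Finset.card_image_iff.1 (e.trans (by simp))))
  obtain ⟨i, j, hij, hne'⟩ : ∃ i j, t i = t j ∧ i ≠ j := by
    simpa [Function.Injective] using ht
  obtain ⟨w, hw⟩ := hole t
  have hw' (k : Fin N) : t k ≠ w := fun e => hw ⟨k, e⟩
  -- Moving `j` to a vacant vertex increases the number of occupied vertices, so induction applies;
  -- `j` is then alone and can be moved back.
  have hmem : Function.update t j w ∈ R := by
    refine ih _ ?_ _ rfl
    have hsub : insert w (Finset.univ.image t) ⊆ Finset.univ.image (Function.update t j w) := by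
      intro v hv
      simp only [Finset.mem_insert, Finset.mem_image, Finset.mem_univ, true_and] at hv ⊢
      rcases hv with rfl | ⟨k, rfl⟩
      · exact ⟨j, by simp⟩
      · by_cases hk : k = j
        · exact ⟨i, by rw [Function.update_of_ne hne', hij, hk]⟩
        · exact ⟨k, by rw [Function.update_of_ne hk]⟩
    have hcard := Finset.card_le_card hsub
    rw [Finset.card_insert_of_notMem (by simpa using hw')] at hcard
    omega
  have hback := hR.update_mem (k := j) hmem (fun k hk => ?_) (t j)
  · simpa using hback
  · simp only [Function.update_apply] at hk
    grind

/-- For a user at `s j`, any vehicle from elsewhere would pass the occupied position `s j`, which is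
excluded in non-null states. -/
theorem IsOptimal.isMovable {G : WeightedDigraph V} (hG : G.StronglyConnected) {Q P : PMF V}
    (hQ : ∀ v, Q v ≠ 0) (hP : ∀ v, P v ≠ 0) {s₁ : Fin N → V} {ρ : AssignmentPolicy V N}
    (hρ : IsOptimal Q P G ρ s₁) : IsMovable {s | ¬ IsNull Q P ρ s₁ s} := by
  intro s hs j
  refine ⟨ρ s (s j), ?_, not_isNull_update hQ hP hs (s j)⟩
  by_contra hne
  exact hs (hρ.isNull hG hQ hP ⟨j, rfl⟩ (Ne.symm hne) (by rw [G.dist_self, add_zero]))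

end AssignmentPolicy

theorem mainTheorem8 {V : Type*} [Fintype V]
    (G : WeightedDigraph V) (hG : G.StronglyConnected)
    (Q P : PMF V) (hQ : ∀ v, Q v ≠ 0) (hP : ∀ v, P v ≠ 0)
    {N : ℕ} (s₁ : Fin N → V) (ρ : AssignmentPolicy V N)
    (hρ : AssignmentPolicy.IsOptimal Q P G ρ s₁)
    (s : Fin N → V) (u v₁ v₂ : V)
    (hv₁ : v₁ ∈ Set.range s) (hv₂ : v₂ ∈ Set.range s) (hne : v₁ ≠ v₂)
    (hpath : ∃ p : G.Walk v₂ u, p.IsShortest ∧ v₁ ∈ p.support) :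
    (ρ.Anonymous ∨ N < Fintype.card V → s (ρ s u) ≠ v₂) ∧
    (s (ρ s u) = v₂ →
      Tendsto (fun T : ℕ =>
        (∑ t ∈ Finset.range T, (AssignmentPolicy.law Q P ρ s₁ t s).toReal) / (T : ℝ))
        atTop (𝓝 0)) := by
  obtain ⟨p, hp, hmem⟩ := hpath
  have hdist := hG.dist_add_dist_le hp hmem
  have hnull (s' : Fin N → V) (hv : v₁ ∈ Set.range s') (e : s' (ρ s' u) = v₂) :
      AssignmentPolicy.IsNull Q P ρ s₁ s' :=
    hρ.isNull hG hQ hP hv (e ▸ hne) (e ▸ hdist)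
  have hmov := hρ.isMovable hG hQ hP
  have hnon := AssignmentPolicy.exists_not_isNull Q P ρ s₁
  refine ⟨?_, hnull s hv₁⟩
  rintro (hanon | hN) e
  -- Anonymity transfers the decision in `s` to a non-null relabelling of `s`.
  · obtain ⟨σ, hσ⟩ := hmov.exists_comp_perm_mem hnon s
    refine hσ (hnull _ ?_ ((hanon s σ u).trans e))
    rwa [σ.surjective.range_comp]
  · exact hmov.mem_of_card_lt hnon hN s (hnull s hv₁ e)
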